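/- Let $\mathbb F\in\{\mathbb R,\mathbb C\}$, let $p,q,r\ge 0$ be integers with $n=p+q+r\ge 1$, and let $\mathcal G=\mathcal G_{p,q,r}$ be the (possibly degenerate) geometric (Clifford) algebra over $\mathbb F$ with generators $e_1,\dots,e_n$ satisfying $e_ae_b+e_be_a=2\eta_{ab}e$, where $\eta$ is diagonal with $p$ entries $+1$, then $q$ entries $-1$, then $r$ entries $0$ (for $\mathbb F=\mathbb C$ one may take $q=0$). Let $\mathcal G^m$ be the subspace spanned by the products $e_{a_1}\cdots e_{a_m}$ with $a_1<\dots<a_m$ (so $\mathcal G^m=\{0\}$ for $m>n$), let $\widehat U$ and $\widetilde U$ denote the grade involution and the reversion of $U$, let $\mathcal G^{(j)}=\{U:\widehat U=(-1)^jU\}$ for $j=0,1$, and write $U=\langle U\rangle_{(0)}+\langle U\rangle_{(1)}$ with $\langle U\rangle_{(j)}\in\mathcal G^{(j)}$. For $k=0,1,2,3$ put $$\mathcal G^{\overline k}=\{U\in\mathcal G:\ \widehat U=(-1)^kU,\ \widetilde U=(-1)^{k(k-1)/2}U\}.$$ Let $\mathcal G^\times$ be the group of invertible elements of $\mathcal G$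 and, for $H\subseteq\mathcal G$, let $H^\times=H\cap\mathcal G^\times$. For $T\in\mathcal G^\times$ and $U\in\mathcal G$ put $$\mathrm{ad}_T(U)=TUT^{-1},\qquad \check{\mathrm{ad}}_T(U)=\widehat T\,U\,T^{-1},\qquad \tilde{\mathrm{ad}}_T(U)=T\langle U\rangle_{(0)}T^{-1}+\widehat T\langle U\rangle_{(1)}T^{-1},$$ and let $\Gamma^{\overline k}$, $\check\Gamma^{\overline k}$, $\tilde\Gamma^{\overline k}$ be the sets of those $T\in\mathcal G^\times$ that map $\mathcal G^{\overline k}$ into itself under $\mathrm{ad}_T$, $\check{\mathrm{ad}}_T$, $\tilde{\mathrm{ad}}_T$, respectively. Define $$\mathrm Z^m=\{X\in\mathcal G: XV=VX\ \ \forall V\in\mathcal G^m\},\qquad \check{\mathrm Z}^m=\{X\in\mathcal G:\widehat XV=VX\ \ \forall V\in\mathcal G^m\},$$ $\psi(T)=\widetilde T\,T$ and $\chi(T)=\widehat{\widetilde T}\,T$, and $$\check{\mathrm Q}^{\overline k}=\{T\in\mathcal G^\times:\psi(T),\chi(T)\in\check{\mathrm Z}^{k\times}\}\ (k=1,2,3),\qquad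 \check{\mathrm Q}^{\overline 0}=\{T\in\mathcal G^\times:\psi(T),\chi(T)\in(\mathrm Z^4\cap\mathcal G^{(0)})^\times\},$$ $$\mathrm Q^{\overline k}=\{T\in\mathcal G^\times:\psi(T),\chi(T)\in\mathrm Z^{k\times}\}\ (k=1,2,3),\qquad \mathrm Q^{\overline 0}=\{T\in\mathcal G^\times:\psi(T),\chi(T)\in\mathrm Z^{4\times}\}.$$ Then $$\check{\mathrm Q}^{\overline 1}=\check\Gamma^{\overline 1}\subseteq\check{\mathrm Q}^{\overline 3}=\check\Gamma^{\overline 3},\qquad \check{\mathrm Q}^{\overline 2}=\check\Gamma^{\overline 2},\qquad \check{\mathrm Q}^{\overline 0}=\check\Gamma^{\overline 0}.$$ Moreover, $\tilde\Gamma^{\overline k}=\check\Gamma^{\overline k}=\check{\mathrm Q}^{\overline k}$ for $k=1,3$, and $\tilde\Gamma^{\overline k}=\Gamma^{\overline k}=\mathrm Q^{\overline k}$ for $k=0,2$. -/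

import Mathlib

noncomputable section

namespace GeomAlg

/-- The diagonal entries of the Gram matrix: `p` times `+1`, `q` times `-1`, `r` times `0`. -/
def eta (𝕜 : Type*) [RCLike 𝕜] (p q r : ℕ) (a : Fin (p + q + r)) : 𝕜 :=
  if (a : ℕ) < p then 1 else if (a : ℕ) < p + q then -1 else 0

/-- The diagonal quadratic form with entries `eta` on `𝕜 ^ (p + q + r)`. -/
def form (𝕜 : Type*) [RCLike 𝕜] (p q r : ℕ) : QuadraticForm 𝕜 (Fin (p + q + r) → 𝕜) :=
  QuadraticMap.weightedSumSquares 𝕜 (eta 𝕜 p q r)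

/-- The geometric (Clifford) algebra with signature `(p, q, r)`. -/
abbrev G (𝕜 : Type*) [RCLike 𝕜] (p q r : ℕ) : Type _ := CliffordAlgebra (form 𝕜 p q r)

variable {𝕜 : Type*} [RCLike 𝕜] {p q r : ℕ}

/-- The generators `e_a`. -/
def gen (a : Fin (p + q + r)) : G 𝕜 p q r :=
  CliffordAlgebra.ι (form 𝕜 p q r) (Pi.single a 1)

/-- The generators square to `η_aa`. -/
theorem gen_mul_self (a : Fin (p + q + r)) :
    (gen a * gen a : G 𝕜 p q r) = algebraMap 𝕜 _ (eta 𝕜 p q r a) := by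
  rw [gen, CliffordAlgebra.ι_sq_scalar]
  congr 1
  rw [form, QuadraticMap.weightedSumSquares_apply, Finset.sum_eq_single a]
  · simp
  · intro b _ hb
    simp [hb]
  · simp

/-- Different generators anticommute. -/
theorem gen_mul_gen_add_swap {a b : Fin (p + q + r)} (h : a ≠ b) :
    (gen a * gen b + gen b * gen a : G 𝕜 p q r) = 0 := by
  rw [gen, gen, CliffordAlgebra.ι_mul_ι_add_swap]
  have : QuadraticMap.polar (form 𝕜 p q r) (Pi.single a 1) (Pi.single b 1) = 0 := by
    simp only [QuadraticMap.polar, form, QuadraticMap.weightedSumSquares_apply,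
      ← Finset.sum_sub_distrib]
    apply Finset.sum_eq_zero
    intro c _
    by_cases hca : c = a
    · subst hca
      simp [h]
    · simp [hca]
  rw [this, map_zero]

/-- The subspace of grade `m`: the span of the products `e_{a_1} ⋯ e_{a_m}`, `a_1 < ⋯ < a_m`. -/
def grade (𝕜 : Type*) [RCLike 𝕜] (p q r m : ℕ) : Submodule 𝕜 (G 𝕜 p q r) :=
  Submodule.span 𝕜
    (Set.range fun a : Fin m ↪o Fin (p + q + r) => (List.ofFn fun i => gen (a i)).prod)

/-- The grade involution. -/
def inv (U : G 𝕜 p q r) : G 𝕜 p q r := CliffordAlgebra.involute U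

/-- The reversion. -/
def rev (U : G 𝕜 p q r) : G 𝕜 p q r := CliffordAlgebra.reverse U

/-- The even (`k = 0`) and odd (`k = 1`) subspaces. -/
def parity (𝕜 : Type*) [RCLike 𝕜] (p q r k : ℕ) : Set (G 𝕜 p q r) :=
  {U | inv U = (-1) ^ k * U}

/-- The subspace of quaternion type `k = 0, 1, 2, 3`. -/
def qtype (𝕜 : Type*) [RCLike 𝕜] (p q r : ℕ) (k : Fin 4) : Set (G 𝕜 p q r) :=
  {U | inv U = (-1) ^ (k : ℕ) * U ∧ rev U = (-1) ^ ((k : ℕ) * ((k : ℕ) - 1) / 2) * U}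

/-- The even component of an element. -/
def proj0 (U : G 𝕜 p q r) : G 𝕜 p q r := (2⁻¹ : 𝕜) • (U + inv U)

/-- The odd component of an element. -/
def proj1 (U : G 𝕜 p q r) : G 𝕜 p q r := (2⁻¹ : 𝕜) • (U - inv U)

theorem proj0_mem (U : G 𝕜 p q r) : proj0 U ∈ parity 𝕜 p q r 0 := by
  simp [proj0, parity, inv, add_comm]

theorem proj1_mem (U : G 𝕜 p q r) : proj1 U ∈ parity 𝕜 p q r 1 := by
  simp [proj1, parity, inv, ← smul_neg]

theorem proj0_add_proj1 (U : G 𝕜 p q r) : proj0 U + proj1 U = U := by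
  rw [proj0, proj1, ← smul_add, add_add_sub_cancel, ← two_smul 𝕜 U, smul_smul,
    inv_mul_cancel₀ two_ne_zero, one_smul]

/-- The adjoint action `T U T⁻¹`. -/
def ad (T : (G 𝕜 p q r)ˣ) (U : G 𝕜 p q r) : G 𝕜 p q r :=
  (T : G 𝕜 p q r) * U * ((T⁻¹ : (G 𝕜 p q r)ˣ) : G 𝕜 p q r)

/-- The first version of the twisted adjoint action. -/
def adCheck (T : (G 𝕜 p q r)ˣ) (U : G 𝕜 p q r) : G 𝕜 p q r :=
  inv (T : G 𝕜 p q r) * U * ((T⁻¹ : (G 𝕜 p q r)ˣ) : G 𝕜 p q r)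

/-- The second version of the twisted adjoint action. -/
def adTilde (T : (G 𝕜 p q r)ˣ) (U : G 𝕜 p q r) : G 𝕜 p q r :=
  (T : G 𝕜 p q r) * proj0 U * ((T⁻¹ : (G 𝕜 p q r)ˣ) : G 𝕜 p q r) +
    inv (T : G 𝕜 p q r) * proj1 U * ((T⁻¹ : (G 𝕜 p q r)ˣ) : G 𝕜 p q r)

/-- The stabilizer of the subspace of quaternion type `k` under `ad`. -/
def Gam (𝕜 : Type*) [RCLike 𝕜] (p q r : ℕ) (k : Fin 4) : Set (G 𝕜 p q r)ˣ :=
  {T | ad T '' qtype 𝕜 p q r k ⊆ qtype 𝕜 p q r k}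

/-- The stabilizer of the subspace of quaternion type `k` under `adCheck`. -/
def GamCheck (𝕜 : Type*) [RCLike 𝕜] (p q r : ℕ) (k : Fin 4) : Set (G 𝕜 p q r)ˣ :=
  {T | adCheck T '' qtype 𝕜 p q r k ⊆ qtype 𝕜 p q r k}

/-- The stabilizer of the subspace of quaternion type `k` under `adTilde`. -/
def GamTilde (𝕜 : Type*) [RCLike 𝕜] (p q r : ℕ) (k : Fin 4) : Set (G 𝕜 p q r)ˣ :=
  {T | adTilde T '' qtype 𝕜 p q r k ⊆ qtype 𝕜 p q r k}

/-- The centralizer of the subspace of grade `m` (the whole algebra if `m > p + q + r`). -/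
def Z (𝕜 : Type*) [RCLike 𝕜] (p q r m : ℕ) : Set (G 𝕜 p q r) :=
  {X | ∀ V ∈ grade 𝕜 p q r m, X * V = V * X}

/-- The twisted centralizer of the subspace of grade `m`. -/
def ZCheck (𝕜 : Type*) [RCLike 𝕜] (p q r m : ℕ) : Set (G 𝕜 p q r) :=
  {X | ∀ V ∈ grade 𝕜 p q r m, inv X * V = V * X}

/-- The invertible elements of a subset `H` of the algebra. -/
def invertibles (H : Set (G 𝕜 p q r)) : Set (G 𝕜 p q r) := {X | X ∈ H ∧ IsUnit X}

/-- The norm function `ψ`. -/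
def psi (T : G 𝕜 p q r) : G 𝕜 p q r := rev T * T

/-- The norm function `χ`. -/
def chi (T : G 𝕜 p q r) : G 𝕜 p q r := inv (rev T) * T

/-- The set of invertible `T` such that both `ψ(T)` and `χ(T)` are invertible elements of `H`. -/
def normSet (H : Set (G 𝕜 p q r)) : Set (G 𝕜 p q r)ˣ :=
  {T | psi (T : G 𝕜 p q r) ∈ invertibles H ∧ chi (T : G 𝕜 p q r) ∈ invertibles H}

/-- The groups `Q` with quaternion type `k`. -/
def Q (𝕜 : Type*) [RCLike 𝕜] (p q r : ℕ) : Fin 4 → Set (G 𝕜 p q r)ˣ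
  | 0 => normSet (Z 𝕜 p q r 4)
  | 1 => normSet (Z 𝕜 p q r 1)
  | 2 => normSet (Z 𝕜 p q r 2)
  | 3 => normSet (Z 𝕜 p q r 3)

/-- The groups `Q̌` with quaternion type `k`. -/
def QCheck (𝕜 : Type*) [RCLike 𝕜] (p q r : ℕ) : Fin 4 → Set (G 𝕜 p q r)ˣ
  | 0 => normSet (Z 𝕜 p q r 4 ∩ parity 𝕜 p q r 0)
  | 1 => normSet (ZCheck 𝕜 p q r 1)
  | 2 => normSet (ZCheck 𝕜 p q r 2)
  | 3 => normSet (ZCheck 𝕜 p q r 3)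

end GeomAlg

end

noncomputable section

namespace GeomAlg

open scoped symmDiff

variable {𝕜 : Type*} [RCLike 𝕜] {p q r : ℕ}

/-! The argument splits into an algebraic reduction and a count of parities. For `U` of quaternion
type `k`, the element `S U T⁻¹` is again of that type exactly when it is compatible with reversion
and with the grade involution. Clearing inverses turns these two conditions into commutation
relations between `U` and norm-like products. With `S = T` they say that `ψ(T)` and `χ(T)`
centralize the type; with `S` the grade involution of `T` they say the same for the twisted
centralizer (`mul_mul_inv_mem_qtype_iff`, `Gam_eq`, `GamCheck_eq`).

It remains to compare the centralizer of a whole quaternion type with that of a single grade. Blades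
form a basis even for a degenerate form (`linearIndependent_blade`), and multiplying by a fixed
blade permutes them up to scalars, so commutation can be tested blade by blade
(`twist_mul_blade_eq_iff`). For a blade `A` the test depends only on how many factors of the other
blade lie inside and outside `A`, a null generator in common making both products vanish. The
comparison is thus the arithmetic of `ParityCond`: the lowest positive grade of the type already
yields every obstruction, except that type 0 also contains the unit, whence the intersection with
the even part in the twisted case. -/

/-! ### Blades: products, commutation signs, involutions, spanning -/

/-- The product of the generators indexed by `A`, in increasing order. -/
def blade (A : Finset (Fin (p + q + r))) : G 𝕜 p q r := (A.sort.map gen).prod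

theorem blade_empty : (blade ∅ : G 𝕜 p q r) = 1 := by
  simp [blade]

theorem blade_insert {i : Fin (p + q + r)} {A : Finset (Fin (p + q + r))}
    (h : ∀ j ∈ A, i < j) : (blade (insert i A) : G 𝕜 p q r) = gen i * blade A := by
  have hi : i ∉ A := fun hi => lt_irrefl i (h i hi)
  rw [blade, Finset.sort_insert _ (fun j hj => (h j hj).le) hi, List.map_cons, List.prod_cons,
    blade]

theorem gen_mul_gen_of_ne {a b : Fin (p + q + r)} (h : a ≠ b) :
    (gen a * gen b : G 𝕜 p q r) = -(gen b * gen a) :=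
  eq_neg_of_add_eq_zero_left (gen_mul_gen_add_swap h)

/-- Only the vanishing of the scalar is recorded: signs enter later solely through
`blade_mul_blade_comm`. -/
theorem gen_mul_blade (i : Fin (p + q + r)) (A : Finset (Fin (p + q + r))) :
    ∃ c : 𝕜, (c = 0 ↔ i ∈ A ∧ eta 𝕜 p q r i = 0) ∧
      gen i * blade A = c • (blade ({i} ∆ A) : G 𝕜 p q r) := by
  induction A using Finset.induction_on_min with
  | empty =>
    refine ⟨1, by simp, ?_⟩
    have h := blade_insert (𝕜 := 𝕜) (i := i) (A := ∅) (by simp)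
    have e : ({i} : Finset (Fin (p + q + r))) ∆ ∅ = insert i ∅ := by simp
    rw [e, h, one_smul]
  | insert j A hj ih =>
    have hjA : j ∉ A := fun h => lt_irrefl j (hj j h)
    rcases lt_trichotomy i j with hij | rfl | hij
    · have h : ∀ k ∈ insert j A, i < k := by
        intro k hk
        rcases Finset.mem_insert.1 hk with rfl | hk
        · exact hij
        · exact hij.trans (hj k hk)
      have hi : i ∉ insert j A := fun hi => lt_irrefl i (h i hi)
      refine ⟨1, by simp only [hi, false_and, one_ne_zero], ?_⟩
      have e : {i} ∆ insert j A = insert i (insert j A) := by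
        ext k
        simp only [Finset.mem_symmDiff, Finset.mem_singleton, Finset.mem_insert]
        grind
      rw [e, blade_insert h, one_smul]
    · refine ⟨eta 𝕜 p q r i, by simp, ?_⟩
      have e : {i} ∆ insert i A = A := by
        ext k
        simp only [Finset.mem_symmDiff, Finset.mem_singleton, Finset.mem_insert]
        grind
      rw [e, blade_insert hj, ← mul_assoc, gen_mul_self, Algebra.smul_def]
    · obtain ⟨c, hc, h⟩ := ih
      refine ⟨-c, ?_, ?_⟩
      · rw [neg_eq_zero, hc, Finset.mem_insert]
        simp [hij.ne']
      have e : {i} ∆ insert j A = insert j ({i} ∆ A) := by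
        ext k
        simp only [Finset.mem_symmDiff, Finset.mem_singleton, Finset.mem_insert]
        grind
      have h' : ∀ k ∈ {i} ∆ A, j < k := by
        intro k
        simp only [Finset.mem_symmDiff, Finset.mem_singleton]
        grind
      rw [e, blade_insert hj, blade_insert h', ← mul_assoc, gen_mul_gen_of_ne hij.ne', neg_mul,
        mul_assoc, h, mul_smul_comm, neg_smul]

theorem blade_mul_blade (B A : Finset (Fin (p + q + r))) :
    ∃ c : 𝕜, (c = 0 ↔ ∃ i ∈ A ∩ B, eta 𝕜 p q r i = 0) ∧
      blade B * blade A = c • (blade (B ∆ A) : G 𝕜 p q r) := by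
  induction B using Finset.induction_on_min with
  | empty =>
    have e : ∅ ∆ A = A := bot_symmDiff A
    exact ⟨1, by simp, by rw [blade_empty, one_mul, one_smul, e]⟩
  | insert j B hj ih =>
    have hjB : j ∉ B := fun h => lt_irrefl j (hj j h)
    obtain ⟨c, hc, h⟩ := ih
    obtain ⟨d, hd, h'⟩ := gen_mul_blade (𝕜 := 𝕜) j (B ∆ A)
    refine ⟨c * d, ?_, ?_⟩
    · rw [mul_eq_zero, hc, hd, Finset.mem_symmDiff]
      grind
    · have e : insert j B ∆ A = {j} ∆ (B ∆ A) := by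
        ext k
        simp only [Finset.mem_symmDiff, Finset.mem_singleton, Finset.mem_insert]
        grind
      rw [blade_insert hj, mul_assoc, h, mul_smul_comm, h', smul_smul, e]

/-- Each factor of the blade other than `gen i` contributes a sign. A factor equal to `gen i` does
not; the exponent corrects for it by adding 1, which has the same parity as subtracting it. -/
theorem blade_mul_gen (A : Finset (Fin (p + q + r))) (i : Fin (p + q + r)) :
    (blade A * gen i : G 𝕜 p q r) =
      (-1 : 𝕜) ^ (A.card + if i ∈ A then 1 else 0) • (gen i * blade A) := by
  induction A using Finset.induction_on_min with
  | empty => simp [blade_empty]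
  | insert j A hj ih =>
    have hjA : j ∉ A := fun h => lt_irrefl j (hj j h)
    rw [blade_insert hj, mul_assoc, ih, mul_smul_comm, ← mul_assoc, ← mul_assoc,
      Finset.card_insert_of_notMem hjA]
    by_cases hij : i = j
    · subst hij
      simp [hjA, pow_add]
    · rw [gen_mul_gen_of_ne (Ne.symm hij), neg_mul]
      by_cases hi : i ∈ A <;> simp [hij, hi, pow_add]

theorem blade_mul_blade_comm (A B : Finset (Fin (p + q + r))) :
    (blade A * blade B : G 𝕜 p q r) =
      (-1 : 𝕜) ^ (A.card * B.card + (A ∩ B).card) • (blade B * blade A) := by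
  induction B using Finset.induction_on_min with
  | empty => simp [blade_empty]
  | insert j B hj ih =>
    have hjB : j ∉ B := fun h => lt_irrefl j (hj j h)
    rw [blade_insert hj, ← mul_assoc, blade_mul_gen, smul_mul_assoc, mul_assoc, ih, mul_smul_comm,
      smul_smul, Finset.card_insert_of_notMem hjB, ← pow_add, mul_assoc]
    congr 2
    by_cases h : j ∈ A
    · have : j ∉ A ∩ B := by simp [hjB]
      rw [Finset.inter_insert_of_mem h, Finset.card_insert_of_notMem this]
      simp only [h, if_true]
      ring
    · rw [Finset.inter_insert_of_notMem h]
      simp only [h, if_false]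
      ring

theorem involute_blade (A : Finset (Fin (p + q + r))) :
    CliffordAlgebra.involute (blade A : G 𝕜 p q r) = (-1 : 𝕜) ^ A.card • blade A := by
  induction A using Finset.induction_on_min with
  | empty => simp [blade_empty]
  | insert j A hj ih =>
    have hjA : j ∉ A := fun h => lt_irrefl j (hj j h)
    rw [blade_insert hj, map_mul, ih, Finset.card_insert_of_notMem hjA, gen,
      CliffordAlgebra.involute_ι]
    simp [pow_succ]

theorem reverse_blade (A : Finset (Fin (p + q + r))) :
    CliffordAlgebra.reverse (blade A : G 𝕜 p q r) =
      (-1 : 𝕜) ^ (A.card * (A.card - 1) / 2) • blade A := by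
  induction A using Finset.induction_on_min with
  | empty => simp [blade_empty]
  | insert j A hj ih =>
    have hjA : j ∉ A := fun h => lt_irrefl j (hj j h)
    have hg : CliffordAlgebra.reverse (gen j : G 𝕜 p q r) = gen j := by
      rw [gen, CliffordAlgebra.reverse_ι]
    rw [blade_insert hj, CliffordAlgebra.reverse.map_mul, ih, Finset.card_insert_of_notMem hjA,
      hg, smul_mul_assoc, blade_mul_gen, smul_smul, Nat.triangle_succ,
      if_neg hjA, add_zero, pow_add]

theorem blade_mem_grade (A : Finset (Fin (p + q + r))) :
    blade A ∈ grade 𝕜 p q r A.card := by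
  apply Submodule.subset_span
  refine ⟨A.orderEmbOfFin rfl, ?_⟩
  simp only
  rw [List.ofFn_eq_map, blade, ← Finset.listMap_orderEmbOfFin_finRange A rfl, List.map_map]
  rfl

theorem grade_eq_span (m : ℕ) :
    grade 𝕜 p q r m = Submodule.span 𝕜 (blade '' {A | A.card = m}) := by
  apply le_antisymm
  · rw [grade, Submodule.span_le]
    rintro _ ⟨a, rfl⟩
    apply Submodule.subset_span
    have hc : (Finset.univ.map a.toEmbedding).card = m := by simp
    refine ⟨Finset.univ.map a.toEmbedding, hc, ?_⟩
    have ha : a = (Finset.univ.map a.toEmbedding).orderEmbOfFin hc :=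
      Finset.orderEmbOfFin_unique' hc (by simp)
    conv_rhs => rw [ha]
    simp only
    rw [List.ofFn_eq_map, blade, ← Finset.listMap_orderEmbOfFin_finRange _ hc, List.map_map]
    rfl
  · rw [Submodule.span_le]
    rintro _ ⟨A, rfl, rfl⟩
    exact blade_mem_grade A

/-- The span contains 1 and is stable under left multiplication by generators, hence by all vectors.
-/
theorem span_range_blade : Submodule.span 𝕜 (Set.range (blade : _ → G 𝕜 p q r)) = ⊤ := by
  rw [eq_top_iff]
  rintro x -
  induction x using CliffordAlgebra.left_induction with
  | algebraMap c =>
    rw [Algebra.algebraMap_eq_smul_one, ← blade_empty]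
    exact Submodule.smul_mem _ _ (Submodule.subset_span ⟨_, rfl⟩)
  | add x y hx hy => exact add_mem hx hy
  | ι_mul x v hx =>
    have hv : CliffordAlgebra.ι (form 𝕜 p q r) v = ∑ i, v i • gen i := by
      conv_lhs => rw [pi_eq_sum_univ' v]
      simp only [map_sum, map_smul, gen]
    rw [hv, Finset.sum_mul]
    refine sum_mem fun i _ => ?_
    rw [smul_mul_assoc]
    refine Submodule.smul_mem _ _ ?_
    have : Submodule.span 𝕜 (Set.range (blade : _ → G 𝕜 p q r)) ≤
        (Submodule.span 𝕜 (Set.range (blade : _ → G 𝕜 p q r))).comap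
          (LinearMap.mulLeft 𝕜 (gen i)) := by
      rw [Submodule.span_le]
      rintro _ ⟨A, rfl⟩
      obtain ⟨c, -, h⟩ := gen_mul_blade (𝕜 := 𝕜) i A
      rw [SetLike.mem_coe, Submodule.mem_comap, LinearMap.mulLeft_apply, h]
      exact Submodule.smul_mem _ _ (Submodule.subset_span ⟨_, rfl⟩)
    exact this hx

/-! ### Linear independence of blades through a coordinate representation -/

/-- The sign `(-1) ^ #{j ∈ S | j < i}`. -/
def lowerSign (𝕜 : Type*) [RCLike 𝕜] {n : ℕ} (i : Fin n) (S : Finset (Fin n)) : 𝕜 :=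
  (-1) ^ (S.filter (· < i)).card

theorem lowerSign_mul_self {n : ℕ} (i : Fin n) (S : Finset (Fin n)) :
    lowerSign 𝕜 i S * lowerSign 𝕜 i S = 1 := by
  rw [lowerSign, ← pow_add]
  exact Even.neg_one_pow ⟨_, rfl⟩

theorem lowerSign_symmDiff_of_le {n : ℕ} {i j : Fin n} (h : i ≤ j) (S : Finset (Fin n)) :
    lowerSign 𝕜 i ({j} ∆ S) = lowerSign 𝕜 i S := by
  rw [lowerSign, lowerSign]
  congr 2
  ext k
  simp only [Finset.mem_filter, Finset.mem_symmDiff, Finset.mem_singleton]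
  grind

theorem lowerSign_symmDiff_of_lt {n : ℕ} {i j : Fin n} (h : j < i) (S : Finset (Fin n)) :
    lowerSign 𝕜 i ({j} ∆ S) = -lowerSign 𝕜 i S := by
  rw [lowerSign, lowerSign]
  by_cases hj : j ∈ S
  · have : S.filter (· < i) = insert j (({j} ∆ S).filter (· < i)) := by
      ext k
      simp only [Finset.mem_filter, Finset.mem_symmDiff, Finset.mem_singleton, Finset.mem_insert]
      grind
    rw [this, Finset.card_insert_of_notMem (by simp [Finset.mem_symmDiff, hj]), pow_succ]
    ring
  · have : ({j} ∆ S).filter (· < i) = insert j (S.filter (· < i)) := by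
      ext k
      simp only [Finset.mem_filter, Finset.mem_symmDiff, Finset.mem_singleton, Finset.mem_insert]
      grind
    rw [this, Finset.card_insert_of_notMem (by simp [hj]), pow_succ]
    ring

/-- The operator by which the generator `e_i` acts on coordinates by left multiplication. -/
def genOp (𝕜 : Type*) [RCLike 𝕜] (p q r : ℕ) (i : Fin (p + q + r)) :
    Module.End 𝕜 (Finset (Fin (p + q + r)) → 𝕜) where
  -- Here `S` is the index set after multiplication: if it lacks `i`, two copies of the generator
  -- have met and produced `eta`. The sign comes from moving the generator past the smaller indices.
  toFun f S := lowerSign 𝕜 i S * (if i ∈ S then 1 else eta 𝕜 p q r i) * f ({i} ∆ S)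
  map_add' f g := by
    funext S
    simp [mul_add]
  map_smul' c f := by
    funext S
    simp only [Pi.smul_apply, smul_eq_mul, RingHom.id_apply]
    ring

theorem genOp_apply (i : Fin (p + q + r)) (f : Finset (Fin (p + q + r)) → 𝕜)
    (S : Finset (Fin (p + q + r))) :
    genOp 𝕜 p q r i f S =
      lowerSign 𝕜 i S * (if i ∈ S then 1 else eta 𝕜 p q r i) * f ({i} ∆ S) := rfl

theorem genOp_mul_self (i : Fin (p + q + r)) :
    genOp 𝕜 p q r i * genOp 𝕜 p q r i = algebraMap 𝕜 _ (eta 𝕜 p q r i) := by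
  refine LinearMap.ext fun f => funext fun S => ?_
  have e : {i} ∆ ({i} ∆ S) = S := symmDiff_symmDiff_cancel_left _ _
  have hi : i ∈ {i} ∆ S ↔ i ∉ S := by simp [Finset.mem_symmDiff]
  simp only [Module.End.mul_apply, genOp_apply, lowerSign_symmDiff_of_le le_rfl, e, hi,
    Module.algebraMap_end_apply, Pi.smul_apply, smul_eq_mul]
  have h := lowerSign_mul_self (𝕜 := 𝕜) i S
  by_cases hS : i ∈ S
  · simp only [hS, not_true_eq_false, if_true, if_false]
    linear_combination eta 𝕜 p q r i * f S * h
  · simp only [hS, not_false_eq_true, if_true, if_false]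
    linear_combination eta 𝕜 p q r i * f S * h

theorem genOp_mul_genOp_add_swap {i j : Fin (p + q + r)} (h : i ≠ j) :
    genOp 𝕜 p q r i * genOp 𝕜 p q r j + genOp 𝕜 p q r j * genOp 𝕜 p q r i = 0 := by
  wlog hij : i < j generalizing i j
  · rw [add_comm (genOp 𝕜 p q r i * _)]
    exact this h.symm (lt_of_le_of_ne (not_lt.1 hij) h.symm)
  refine LinearMap.ext fun f => funext fun S => ?_
  have e : {j} ∆ ({i} ∆ S) = {i} ∆ ({j} ∆ S) := symmDiff_left_comm _ _ _
  have hi : i ∈ {j} ∆ S ↔ i ∈ S := by simp [Finset.mem_symmDiff, h]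
  have hj : j ∈ {i} ∆ S ↔ j ∈ S := by simp [Finset.mem_symmDiff, h.symm]
  simp only [LinearMap.add_apply, Pi.add_apply, Module.End.mul_apply, genOp_apply,
    lowerSign_symmDiff_of_le hij.le, lowerSign_symmDiff_of_lt hij, e, hi, hj,
    LinearMap.zero_apply, Pi.zero_apply]
  ring

theorem sum_smul_genOp_mul_self (v : Fin (p + q + r) → 𝕜) :
    (∑ i, v i • genOp 𝕜 p q r i) * (∑ i, v i • genOp 𝕜 p q r i) =
      algebraMap 𝕜 _ (form 𝕜 p q r v) := by
  -- Adding the double sum to its transpose produces anticommutators, so only diagonal terms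
  -- survive; the factor 2 is cancelled at the end.
  have h2 : ((∑ i, v i • genOp 𝕜 p q r i) * (∑ i, v i • genOp 𝕜 p q r i)) +
      ((∑ i, v i • genOp 𝕜 p q r i) * (∑ i, v i • genOp 𝕜 p q r i)) =
      algebraMap 𝕜 _ (form 𝕜 p q r v) + algebraMap 𝕜 _ (form 𝕜 p q r v) := by
    conv_lhs =>
      rw [Finset.sum_mul_sum]
      arg 2
      rw [Finset.sum_comm]
    rw [← Finset.sum_add_distrib, form, QuadraticMap.weightedSumSquares_apply, map_sum,
      ← Finset.sum_add_distrib]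
    refine Finset.sum_congr rfl fun i _ => ?_
    rw [← Finset.sum_add_distrib, Finset.sum_eq_single i]
    · rw [smul_mul_smul_comm, genOp_mul_self]
      simp only [smul_eq_mul, map_mul, Algebra.smul_def]
      simp only [← map_mul, mul_comm]
    · intro j _ hj
      rw [smul_mul_smul_comm, smul_mul_smul_comm, mul_comm (v j), ← smul_add,
        genOp_mul_genOp_add_swap hj.symm, smul_zero]
    · simp
  rw [← two_smul 𝕜, ← two_smul 𝕜 (algebraMap 𝕜 _ _)] at h2
  exact smul_right_injective _ (two_ne_zero (α := 𝕜)) h2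

/-- The left regular representation in coordinates. -/
def coordRep (𝕜 : Type*) [RCLike 𝕜] (p q r : ℕ) :
    G 𝕜 p q r →ₐ[𝕜] Module.End 𝕜 (Finset (Fin (p + q + r)) → 𝕜) :=
  CliffordAlgebra.lift (form 𝕜 p q r)
    ⟨Fintype.linearCombination 𝕜 (genOp 𝕜 p q r), fun v => by
      rw [Fintype.linearCombination_apply]
      exact sum_smul_genOp_mul_self v⟩

theorem coordRep_gen (i : Fin (p + q + r)) :
    coordRep 𝕜 p q r (gen i) = genOp 𝕜 p q r i := by
  rw [coordRep, gen, CliffordAlgebra.lift_ι_apply, Fintype.linearCombination_apply_single,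
    one_smul]

theorem coordRep_blade (A : Finset (Fin (p + q + r))) :
    coordRep 𝕜 p q r (blade A) (Pi.single ∅ 1) = Pi.single A 1 := by
  induction A using Finset.induction_on_min with
  | empty => simp [blade_empty]
  | insert j A hj ih =>
    have hjA : j ∉ A := fun h => lt_irrefl j (hj j h)
    rw [blade_insert hj, map_mul, Module.End.mul_apply, ih, coordRep_gen]
    funext S
    rw [genOp_apply, Pi.single_apply, Pi.single_apply]
    have e : {j} ∆ S = A ↔ S = insert j A := by
      constructor
      · rintro rfl
        ext k
        have := @Finset.mem_symmDiff _ _ {j} S j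
        simp only [Finset.mem_symmDiff, Finset.mem_singleton, Finset.mem_insert] at *
        grind
      · rintro rfl
        ext k
        simp only [Finset.mem_symmDiff, Finset.mem_singleton, Finset.mem_insert]
        grind
    by_cases hS : S = insert j A
    · have hl : lowerSign 𝕜 j S = 1 := by
        have : S.filter (· < j) = ∅ := by
          subst hS
          ext k
          simp only [Finset.mem_filter, Finset.mem_insert, Finset.notMem_empty, iff_false, not_and]
          rintro (rfl | hk)
          · exact lt_irrefl _
          · exact (hj k hk).not_gt
        rw [lowerSign, this]
        simp
      rw [if_pos (e.2 hS), if_pos hS, hl, if_pos (by simp [hS])]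
      simp
    · rw [if_neg (fun h => hS (e.1 h)), if_neg hS, mul_zero]

/-- Applying `coordRep` to the indicator of the empty set sends the blades to the standard basis,
whatever the rank of the form. -/
theorem linearIndependent_blade : LinearIndependent 𝕜 (blade : _ → G 𝕜 p q r) := by
  have h : LinearIndependent 𝕜
      (((LinearMap.applyₗ (Pi.single ∅ 1 : Finset (Fin (p + q + r)) → 𝕜)).comp
        (coordRep 𝕜 p q r).toLinearMap) ∘ blade) := by
    have e : ((LinearMap.applyₗ (Pi.single ∅ 1 : Finset (Fin (p + q + r)) → 𝕜)).comp
        (coordRep 𝕜 p q r).toLinearMap) ∘ blade = Pi.basisFun 𝕜 _ := by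
      funext A
      rw [Pi.basisFun_apply]
      exact coordRep_blade A
    rw [e]
    exact (Pi.basisFun 𝕜 _).linearIndependent
  exact h.of_comp _

/-- The basis of the geometric algebra consisting of the blades. -/
def bladeBasis (𝕜 : Type*) [RCLike 𝕜] (p q r : ℕ) :
    Module.Basis (Finset (Fin (p + q + r))) 𝕜 (G 𝕜 p q r) :=
  Module.Basis.mk linearIndependent_blade span_range_blade.ge

theorem bladeBasis_apply (A : Finset (Fin (p + q + r))) : bladeBasis 𝕜 p q r A = blade A :=
  Module.Basis.mk_apply _ _ A

theorem sum_repr_blade (X : G 𝕜 p q r) :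
    X = ∑ A, (bladeBasis 𝕜 p q r).repr X A • blade A := by
  conv_lhs => rw [← (bladeBasis 𝕜 p q r).sum_repr X]
  simp only [bladeBasis_apply]

/-! ### Twisted commutation tested blade by blade -/

/-- The `τ`-th power of the grade involution. -/
def twist (τ : ℕ) : G 𝕜 p q r →ₗ[𝕜] G 𝕜 p q r :=
  (CliffordAlgebra.involute (Q := form 𝕜 p q r)).toLinearMap ^ τ

theorem twist_zero (X : G 𝕜 p q r) : twist 0 X = X := rfl

theorem twist_one (X : G 𝕜 p q r) : twist 1 X = inv X := by
  rw [twist, pow_one]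
  rfl

theorem twist_blade (τ : ℕ) (A : Finset (Fin (p + q + r))) :
    twist τ (blade A : G 𝕜 p q r) = (-1 : 𝕜) ^ (τ * A.card) • blade A := by
  induction τ with
  | zero => simp [twist_zero]
  | succ τ ih =>
    have h : twist (τ + 1) (blade A : G 𝕜 p q r) =
        CliffordAlgebra.involute (twist τ (blade A : G 𝕜 p q r)) := by
      rw [twist, pow_succ', Module.End.mul_apply]
      rfl
    rw [h, ih, map_smul, involute_blade, smul_smul, ← pow_add]
    congr 2
    ring

/-- The map `A ↦ B ∆ A` is injective, so the contributions of different blades of `X` to the twisted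
commutator cannot cancel. Each must vanish by itself, either because a null generator is shared or
because the total sign is `+1`. -/
theorem twist_mul_blade_eq_iff (τ : ℕ) (X : G 𝕜 p q r) (B : Finset (Fin (p + q + r))) :
    twist τ X * blade B = blade B * X ↔
      ∀ A, (bladeBasis 𝕜 p q r).repr X A ≠ 0 → (∀ i ∈ A ∩ B, eta 𝕜 p q r i ≠ 0) →
        Even (τ * A.card + A.card * B.card + (A ∩ B).card) := by
  choose c hc h using fun A => blade_mul_blade (𝕜 := 𝕜) B A
  set x := (bladeBasis 𝕜 p q r).repr X with hx
  have key : twist τ X * blade B - blade B * X =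
      ∑ A, (x A * ((-1) ^ (τ * A.card + A.card * B.card + (A ∩ B).card) - 1) * c A) •
        (blade (B ∆ A) : G 𝕜 p q r) := by
    conv_lhs => rw [sum_repr_blade X]
    rw [map_sum, Finset.sum_mul, Finset.mul_sum, ← Finset.sum_sub_distrib]
    refine Finset.sum_congr rfl fun A _ => ?_
    rw [map_smul, twist_blade, smul_mul_assoc, smul_mul_assoc, mul_smul_comm, ← hx,
      blade_mul_blade_comm A B, h, smul_smul, smul_smul, smul_smul, smul_smul, ← sub_smul]
    congr 1
    rw [pow_add, pow_add, pow_add]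
    ring
  have hli : LinearIndependent 𝕜 fun A => (blade (B ∆ A) : G 𝕜 p q r) :=
    linearIndependent_blade.comp (fun A => B ∆ A) (symmDiff_right_injective B)
  have hne : (-1 : 𝕜) ≠ 1 := by
    intro h
    have : (2 : 𝕜) = 0 := by linear_combination -h
    exact two_ne_zero this
  rw [← sub_eq_zero, key]
  constructor
  · intro h0 A hA hn
    have := Fintype.linearIndependent_iff.1 hli _ h0 A
    have hcA : c A ≠ 0 := by
      rw [Ne, hc]
      rintro ⟨i, hi, hi'⟩
      exact hn i hi hi'
    rcases mul_eq_zero.1 this with h1 | h1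
    · rcases mul_eq_zero.1 h1 with h2 | h2
      · exact absurd h2 hA
      · exact (neg_one_pow_eq_one_iff_even hne).1 (sub_eq_zero.1 h2)
    · exact absurd h1 hcA
  · intro H
    refine Finset.sum_eq_zero fun A _ => ?_
    by_cases hA : x A = 0
    · rw [hA, zero_mul, zero_mul, zero_smul]
    by_cases hcA : c A = 0
    · rw [hcA, mul_zero, zero_smul]
    have hev := H A hA fun i hi hi' => hcA ((hc A).2 ⟨i, hi, hi'⟩)
    rw [hev.neg_one_pow, sub_self, mul_zero, zero_mul, zero_smul]

/-- The number of elements of `A` that index generators with nonzero square. -/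
def nonnull (𝕜 : Type*) [RCLike 𝕜] {p q r : ℕ} (A : Finset (Fin (p + q + r))) : ℕ :=
  (A.filter (eta 𝕜 p q r · ≠ 0)).card

/-- Only the sizes `i` of `A ∩ B` and `j` of `B \ A` matter. Every admissible pair occurs: take `i`
non-null indices in `A` and `j` indices outside it. -/
theorem forall_inter_iff (A : Finset (Fin (p + q + r))) (P : ℕ → ℕ → Prop) :
    (∀ B, (∀ i ∈ A ∩ B, eta 𝕜 p q r i ≠ 0) → P B.card (A ∩ B).card) ↔
      ∀ i j, i ≤ nonnull 𝕜 A → j ≤ Aᶜ.card → P (i + j) i := by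
  constructor
  · intro h i j hi hj
    obtain ⟨s, hs, rfl⟩ := Finset.exists_subset_card_eq hi
    obtain ⟨t, ht, rfl⟩ := Finset.exists_subset_card_eq hj
    have hsA : s ⊆ A := hs.trans (Finset.filter_subset _ _)
    have hd : Disjoint A t := disjoint_compl_right.mono_right ht
    have e : A ∩ (s ∪ t) = s := by
      rw [Finset.inter_union_distrib_left, Finset.inter_eq_right.2 hsA,
        Finset.disjoint_iff_inter_eq_empty.1 hd, Finset.union_empty]
    have := h (s ∪ t)
    rw [e, Finset.card_union_of_disjoint (hd.mono_left hsA)] at this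
    exact this fun i hi => (Finset.mem_filter.1 (hs hi)).2
  · intro h B hB
    have h1 : (A ∩ B).card ≤ nonnull 𝕜 A :=
      Finset.card_le_card fun i hi =>
        Finset.mem_filter.2 ⟨(Finset.mem_inter.1 hi).1, hB i hi⟩
    have h2 : (B \ A).card ≤ Aᶜ.card :=
      Finset.card_le_card fun i hi => Finset.mem_compl.2 (Finset.mem_sdiff.1 hi).2
    have h3 : (A ∩ B).card + (B \ A).card = B.card := by
      rw [Finset.inter_comm, Finset.card_inter_add_card_sdiff]
    have := h _ _ h1 h2
    rwa [h3] at this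

theorem forall_mem_span_blade_iff (τ : ℕ) (X : G 𝕜 p q r) (S : ℕ → Prop) :
    (∀ V ∈ Submodule.span 𝕜 (blade '' {A | S A.card}), twist τ X * V = V * X) ↔
      ∀ A, (bladeBasis 𝕜 p q r).repr X A ≠ 0 → ∀ i j, i ≤ nonnull 𝕜 A → j ≤ Aᶜ.card →
        S (i + j) → Even (τ * A.card + A.card * (i + j) + i) := by
  have h1 : (∀ V ∈ Submodule.span 𝕜 (blade '' {A | S A.card}), twist τ X * V = V * X) ↔
      ∀ B : Finset (Fin (p + q + r)), S B.card → twist τ X * blade B = blade B * X := by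
    constructor
    · intro h B hB
      exact h _ (Submodule.subset_span ⟨B, hB, rfl⟩)
    · intro h V hV
      induction hV using Submodule.span_induction with
      | mem V hV =>
        obtain ⟨B, hB, rfl⟩ := hV
        exact h B hB
      | zero => simp
      | add V W _ _ hV hW => rw [mul_add, add_mul, hV, hW]
      | smul c V _ hV => rw [mul_smul_comm, smul_mul_assoc, hV]
  have h2 := fun A : Finset (Fin (p + q + r)) => forall_inter_iff (𝕜 := 𝕜) A
    (fun b i => S b → Even (τ * A.card + A.card * b + i))
  rw [h1]
  simp only [twist_mul_blade_eq_iff]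
  constructor
  · intro h A hA
    exact (h2 A).1 fun B hB hS => h B hS A hA hB
  · intro h B hS A hA hB
    exact (h2 A).2 (h A hA) B hB hS

/-! ### Quaternion types as spans of blades -/

theorem repr_involute (V : G 𝕜 p q r) (A : Finset (Fin (p + q + r))) :
    (bladeBasis 𝕜 p q r).repr (inv V) A =
      (-1) ^ A.card * (bladeBasis 𝕜 p q r).repr V A := by
  have h : (bladeBasis 𝕜 p q r).coord A ∘ₗ CliffordAlgebra.involute.toLinearMap =
      (-1 : 𝕜) ^ A.card • (bladeBasis 𝕜 p q r).coord A := by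
    refine (bladeBasis 𝕜 p q r).ext fun B => ?_
    simp only [LinearMap.comp_apply, AlgHom.toLinearMap_apply, LinearMap.smul_apply]
    rw [bladeBasis_apply, involute_blade, map_smul, ← bladeBasis_apply,
      Module.Basis.coord_apply, Module.Basis.repr_self]
    by_cases hAB : B = A
    · rw [hAB]
    · simp [hAB]
  exact LinearMap.congr_fun h V

theorem repr_reverse (V : G 𝕜 p q r) (A : Finset (Fin (p + q + r))) :
    (bladeBasis 𝕜 p q r).repr (rev V) A =
      (-1) ^ (A.card * (A.card - 1) / 2) * (bladeBasis 𝕜 p q r).repr V A := by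
  have h : (bladeBasis 𝕜 p q r).coord A ∘ₗ CliffordAlgebra.reverse =
      (-1 : 𝕜) ^ (A.card * (A.card - 1) / 2) • (bladeBasis 𝕜 p q r).coord A := by
    refine (bladeBasis 𝕜 p q r).ext fun B => ?_
    simp only [LinearMap.comp_apply, LinearMap.smul_apply]
    rw [bladeBasis_apply, reverse_blade, map_smul, ← bladeBasis_apply,
      Module.Basis.coord_apply, Module.Basis.repr_self]
    by_cases hAB : B = A
    · rw [hAB]
    · simp [hAB]
  exact LinearMap.congr_fun h V

theorem neg_one_pow_eq_neg_one_pow_iff (a b : ℕ) :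
    ((-1 : 𝕜) ^ a = (-1) ^ b) ↔ a % 2 = b % 2 := by
  have hne : (-1 : 𝕜) ≠ 1 := by
    intro h
    have : (2 : 𝕜) = 0 := by linear_combination -h
    exact two_ne_zero this
  rw [neg_one_pow_eq_pow_mod_two a, neg_one_pow_eq_pow_mod_two b]
  rcases Nat.mod_two_eq_zero_or_one a with ha | ha <;>
    rcases Nat.mod_two_eq_zero_or_one b with hb | hb <;> simp [ha, hb, hne, hne.symm]

/-- Passing from `m` to `m + 4` adds `4 * m + 6`, which is even. -/
theorem triangle_mod_two (m : ℕ) :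
    (m * (m - 1) / 2) % 2 = ((m % 4) * (m % 4 - 1) / 2) % 2 := by
  induction m using Nat.strong_induction_on with
  | _ m ih =>
    rcases lt_or_ge m 4 with h | h
    · rw [Nat.mod_eq_of_lt h]
    · obtain ⟨n, rfl⟩ := Nat.exists_eq_add_of_le' h
      rw [Nat.add_mod_right, ← ih n (by omega), Nat.triangle_succ, Nat.triangle_succ,
        Nat.triangle_succ, Nat.triangle_succ]
      omega

theorem sign_conditions_iff (m : ℕ) (k : Fin 4) :
    (m % 2 = (k : ℕ) % 2 ∧ (m * (m - 1) / 2) % 2 = ((k : ℕ) * ((k : ℕ) - 1) / 2) % 2) ↔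
      m % 4 = k := by
  rw [triangle_mod_two]
  have h : m % 2 = (m % 4) % 2 := by omega
  rw [h]
  have h4 : m % 4 < 4 := Nat.mod_lt _ (by norm_num)
  generalize m % 4 = s at h4
  fin_cases k <;> interval_cases s <;> simp

theorem neg_one_pow_mul_eq_smul (k : ℕ) (U : G 𝕜 p q r) :
    (-1) ^ k * U = (-1 : 𝕜) ^ k • U := by
  rw [Algebra.smul_def]
  simp

/-- Both involutions are diagonal in the blade basis, and their two signs together determine the
grade modulo 4. -/
theorem qtype_eq_span (k : Fin 4) :
    qtype 𝕜 p q r k =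
      (Submodule.span 𝕜 (blade '' {A | A.card % 4 = (k : ℕ)}) : Submodule 𝕜 (G 𝕜 p q r)) := by
  ext V
  have h : V ∈ qtype 𝕜 p q r k ↔
      ∀ A, (bladeBasis 𝕜 p q r).repr V A ≠ 0 → A.card % 4 = (k : ℕ) := by
    simp only [qtype, Set.mem_ofPred_eq, neg_one_pow_mul_eq_smul]
    rw [← (bladeBasis 𝕜 p q r).repr.injective.eq_iff,
      ← (bladeBasis 𝕜 p q r).repr.injective.eq_iff, Finsupp.ext_iff, Finsupp.ext_iff,
      ← forall_and]
    refine forall_congr' fun A => ?_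
    rw [repr_involute, repr_reverse, map_smul, map_smul, Finsupp.smul_apply, Finsupp.smul_apply,
      smul_eq_mul, smul_eq_mul, mul_eq_mul_right_iff, mul_eq_mul_right_iff,
      neg_one_pow_eq_neg_one_pow_iff, neg_one_pow_eq_neg_one_pow_iff, ← sign_conditions_iff]
    tauto
  rw [h]
  constructor
  · intro h
    rw [sum_repr_blade V]
    refine sum_mem fun A _ => ?_
    by_cases hA : (bladeBasis 𝕜 p q r).repr V A = 0
    · rw [hA, zero_smul]
      exact zero_mem _
    · exact Submodule.smul_mem _ _ (Submodule.subset_span ⟨A, h A hA, rfl⟩)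
  · intro hV
    have e : (blade '' {A | A.card % 4 = (k : ℕ)} : Set (G 𝕜 p q r)) =
        bladeBasis 𝕜 p q r '' {A | A.card % 4 = (k : ℕ)} :=
      Set.image_congr fun A _ => (bladeBasis_apply A).symm
    rw [SetLike.mem_coe, e, Module.Basis.mem_span_image] at hV
    intro A hA
    exact hV (Finsupp.mem_support_iff.2 hA)

/-! ### From one grade to a whole quaternion type: parity arithmetic -/

/-- The `τ`-twisted centralizer of the subspace of quaternion type `k`. -/
def typeCentralizer (𝕜 : Type*) [RCLike 𝕜] (p q r τ : ℕ) (k : Fin 4) : Set (G 𝕜 p q r) :=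
  {X | ∀ V ∈ qtype 𝕜 p q r k, twist τ X * V = V * X}

/-- The parity condition under which a blade with `N` factors, `a` of which have nonzero square and
`c` of whose complementary generators are available, commutes up to the `τ`-twist with all blades
whose number of factors satisfies `S`. -/
def ParityCond (τ N a c : ℕ) (S : ℕ → Prop) : Prop :=
  ∀ i j, i ≤ a → j ≤ c → S (i + j) → Even (τ * N + N * (i + j) + i)

theorem mem_typeCentralizer_iff {τ : ℕ} {k : Fin 4} {X : G 𝕜 p q r} :
    X ∈ typeCentralizer 𝕜 p q r τ k ↔
      ∀ A, (bladeBasis 𝕜 p q r).repr X A ≠ 0 →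
        ParityCond τ A.card (nonnull 𝕜 A) Aᶜ.card (· % 4 = (k : ℕ)) := by
  rw [typeCentralizer, qtype_eq_span]
  exact forall_mem_span_blade_iff τ X (· % 4 = (k : ℕ))

theorem forall_mem_grade_iff (τ m : ℕ) (X : G 𝕜 p q r) :
    (∀ V ∈ grade 𝕜 p q r m, twist τ X * V = V * X) ↔
      ∀ A, (bladeBasis 𝕜 p q r).repr X A ≠ 0 →
        ParityCond τ A.card (nonnull 𝕜 A) Aᶜ.card (· = m) := by
  rw [grade_eq_span]
  exact forall_mem_span_blade_iff τ X (· = m)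

theorem mem_Z_iff {m : ℕ} {X : G 𝕜 p q r} :
    X ∈ Z 𝕜 p q r m ↔ ∀ A, (bladeBasis 𝕜 p q r).repr X A ≠ 0 →
      ParityCond 0 A.card (nonnull 𝕜 A) Aᶜ.card (· = m) :=
  forall_mem_grade_iff 0 m X

theorem mem_ZCheck_iff {m : ℕ} {X : G 𝕜 p q r} :
    X ∈ ZCheck 𝕜 p q r m ↔ ∀ A, (bladeBasis 𝕜 p q r).repr X A ≠ 0 →
      ParityCond 1 A.card (nonnull 𝕜 A) Aᶜ.card (· = m) := by
  rw [← forall_mem_grade_iff, twist_one]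
  rfl

theorem ParityCond.mono {τ N a c : ℕ} {S S' : ℕ → Prop} (h : ParityCond τ N a c S)
    (hS : ∀ m, S' m → S m) : ParityCond τ N a c S' :=
  fun i j hi hj hij => h i j hi hj (hS _ hij)

/-- For `i + j` odd the terms in `N` cancel modulo 2 and `i` must be even. The pair (1, 0) therefore
forces `a = 0`, which disposes of every odd grade. -/
theorem ParityCond.one_odd {N a c : ℕ} (h : ParityCond 1 N a c (· = 1)) :
    ParityCond 1 N a c (· % 2 = 1) := by
  intro i j hi hj hS
  have h0 := h 1 0
  simp [Nat.even_add, Nat.even_mul] at h0 hS ⊢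
  simp only [Nat.even_iff] at *
  omega

/-- Again `i` must be even. The pairs (1, 2) and (3, 0) rule out `a ≥ 1` with `c ≥ 2`, and `a ≥ 3`,
so no odd `i` remains in grades 3 modulo 4. -/
theorem ParityCond.one_three {N a c : ℕ} (h : ParityCond 1 N a c (· = 3)) :
    ParityCond 1 N a c (· % 4 = 3) := by
  intro i j hi hj hS
  have h1 := h 1 2
  have h3 := h 3 0
  simp [Nat.even_add, Nat.even_mul] at h1 h3 hS ⊢
  simp only [Nat.even_iff, Nat.odd_iff] at *
  omega

/-- For `i + j` even the condition reads `N + i` even. In grades 2 modulo 4, an odd `i` makes (1, 1)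
available, and an even `i` makes (0, 2) or (2, 0) available; these fix the parity of `N`. -/
theorem ParityCond.one_two {N a c : ℕ} (h : ParityCond 1 N a c (· = 2)) :
    ParityCond 1 N a c (· % 4 = 2) := by
  intro i j hi hj hS
  have h0 := h 0 2
  have h1 := h 1 1
  have h2 := h 2 0
  simp [Nat.even_add, Nat.even_mul] at h0 h1 h2 hS ⊢
  simp only [Nat.even_iff, Nat.odd_iff] at *
  omega

/-- The condition is that `i` be even. An odd `i` has an odd `j`, so the pair (1, 1) would already
be a violation. -/
theorem ParityCond.zero_two {N a c : ℕ} (h : ParityCond 0 N a c (· = 2)) :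
    ParityCond 0 N a c (· % 4 = 2) := by
  intro i j hi hj hS
  have h1 := h 1 1
  simp [Nat.even_add, Nat.even_mul] at h1 hS ⊢
  simp only [Nat.even_iff] at *
  omega

/-- If `i` is odd and `i + j` is divisible by 4, then either `i = 1` and `j ≥ 3`, or `i ≥ 3` and `j
≥ 1`; the pairs (1, 3) and (3, 1) exclude both. -/
theorem ParityCond.zero_four {N a c : ℕ} (h : ParityCond 0 N a c (· = 4)) :
    ParityCond 0 N a c (· % 4 = 0) := by
  intro i j hi hj hS
  have h1 := h 1 3
  have h3 := h 3 1
  simp [Nat.even_add, Nat.even_mul] at h1 h3 hS ⊢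
  simp only [Nat.even_iff, Nat.odd_iff, or_true, true_iff] at *
  omega

theorem ZCheck_one_eq : ZCheck 𝕜 p q r 1 = typeCentralizer 𝕜 p q r 1 1 := by
  ext X
  rw [mem_ZCheck_iff, mem_typeCentralizer_iff]
  exact forall₂_congr fun A _ => ⟨fun h => h.one_odd.mono fun m (hm : m % 4 = 1) => by omega,
    fun h => h.mono fun m hm => by subst hm; rfl⟩

theorem ZCheck_two_eq : ZCheck 𝕜 p q r 2 = typeCentralizer 𝕜 p q r 1 2 := by
  ext X
  rw [mem_ZCheck_iff, mem_typeCentralizer_iff]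
  exact forall₂_congr fun A _ => ⟨fun h => h.one_two, fun h => h.mono fun m hm => by subst hm; rfl⟩

theorem ZCheck_three_eq : ZCheck 𝕜 p q r 3 = typeCentralizer 𝕜 p q r 1 3 := by
  ext X
  rw [mem_ZCheck_iff, mem_typeCentralizer_iff]
  exact forall₂_congr fun A _ => ⟨fun h => h.one_three,
    fun h => h.mono fun m hm => by subst hm; rfl⟩

theorem ZCheck_one_subset_three : ZCheck 𝕜 p q r 1 ⊆ ZCheck 𝕜 p q r 3 := by
  intro X hX
  rw [mem_ZCheck_iff] at *
  exact fun A hA => (hX A hA).one_odd.mono fun m hm => by subst hm; rfl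

theorem Z_two_eq : Z 𝕜 p q r 2 = typeCentralizer 𝕜 p q r 0 2 := by
  ext X
  rw [mem_Z_iff, mem_typeCentralizer_iff]
  exact forall₂_congr fun A _ => ⟨fun h => h.zero_two,
    fun h => h.mono fun m hm => by subst hm; rfl⟩

theorem Z_four_eq : Z 𝕜 p q r 4 = typeCentralizer 𝕜 p q r 0 0 := by
  ext X
  rw [mem_Z_iff, mem_typeCentralizer_iff]
  exact forall₂_congr fun A _ => ⟨fun h => h.zero_four,
    fun h => h.mono fun m hm => by subst hm; rfl⟩

/-- The unit has type 0, and twisted commutation with it forces `X` to be even; for even `X` the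
twist disappears. -/
theorem Z_four_inter_parity_eq :
    Z 𝕜 p q r 4 ∩ parity 𝕜 p q r 0 = typeCentralizer 𝕜 p q r 1 0 := by
  rw [Z_four_eq]
  ext X
  have h1 : (1 : G 𝕜 p q r) ∈ qtype 𝕜 p q r 0 := by
    simp [qtype, inv, rev]
  constructor
  · rintro ⟨h, hX⟩ V hV
    have hX' : inv X = X := by simpa [parity] using hX
    rw [twist_one, hX']
    exact h V hV
  · intro h
    have hX : inv X = X := by
      have := h 1 h1
      rwa [twist_one, mul_one, one_mul] at this
    refine ⟨fun V hV => ?_, by simpa [parity] using hX⟩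
    have := h V hV
    rwa [twist_one, hX] at this

/-! ### Stabilizers as preimages of centralizers under the norm functions -/

theorem inv_inv_apply (U : G 𝕜 p q r) : inv (inv U) = U := CliffordAlgebra.involute_involute U

theorem inv_mul (U V : G 𝕜 p q r) : inv (U * V) = inv U * inv V := map_mul _ U V

theorem rev_mul (U V : G 𝕜 p q r) : rev (U * V) = rev V * rev U :=
  CliffordAlgebra.reverse.map_mul U V

theorem inv_rev (U : G 𝕜 p q r) : inv (rev U) = rev (inv U) :=
  (CliffordAlgebra.reverse_involute U).symm

theorem rev_one : rev (1 : G 𝕜 p q r) = 1 := CliffordAlgebra.reverse.map_one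

/-- The grade involution of a unit. -/
def invUnit (T : (G 𝕜 p q r)ˣ) : (G 𝕜 p q r)ˣ :=
  Units.map (CliffordAlgebra.involute : G 𝕜 p q r →ₐ[𝕜] G 𝕜 p q r) T

theorem coe_invUnit (T : (G 𝕜 p q r)ˣ) : (invUnit T : G 𝕜 p q r) = inv (T : G 𝕜 p q r) := rfl

theorem coe_inv_invUnit (T : (G 𝕜 p q r)ˣ) :
    (((invUnit T)⁻¹ : (G 𝕜 p q r)ˣ) : G 𝕜 p q r) = inv ((T⁻¹ : (G 𝕜 p q r)ˣ) : G 𝕜 p q r) := rfl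

/-- The reversion of a unit. -/
def revUnit (T : (G 𝕜 p q r)ˣ) : (G 𝕜 p q r)ˣ where
  val := rev (T : G 𝕜 p q r)
  inv := rev ((T⁻¹ : (G 𝕜 p q r)ˣ) : G 𝕜 p q r)
  val_inv := by rw [← rev_mul, Units.inv_mul, rev_one]
  inv_val := by rw [← rev_mul, Units.mul_inv, rev_one]

theorem coe_revUnit (T : (G 𝕜 p q r)ˣ) : (revUnit T : G 𝕜 p q r) = rev (T : G 𝕜 p q r) := rfl

theorem coe_inv_revUnit (T : (G 𝕜 p q r)ˣ) :
    (((revUnit T)⁻¹ : (G 𝕜 p q r)ˣ) : G 𝕜 p q r) = rev ((T⁻¹ : (G 𝕜 p q r)ˣ) : G 𝕜 p q r) := rfl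

theorem mem_normSet_iff {H : Set (G 𝕜 p q r)} {T : (G 𝕜 p q r)ˣ} :
    T ∈ normSet H ↔ psi (T : G 𝕜 p q r) ∈ H ∧ chi (T : G 𝕜 p q r) ∈ H := by
  have h1 : IsUnit (psi (T : G 𝕜 p q r)) := (revUnit T * T).isUnit
  have h2 : IsUnit (chi (T : G 𝕜 p q r)) := (invUnit (revUnit T) * T).isUnit
  simp [normSet, invertibles, h1, h2]

theorem normSet_mono {H K : Set (G 𝕜 p q r)} (h : H ⊆ K) : normSet H ⊆ normSet K := by
  intro T
  rw [mem_normSet_iff, mem_normSet_iff]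
  exact And.imp (@h _) (@h _)

theorem units_conj_eq_iff {M : Type*} [Monoid M] (R S C T : Mˣ) (U : M) :
    ((R⁻¹ : Mˣ) : M) * U * C = S * U * ((T⁻¹ : Mˣ) : M) ↔ (R : M) * S * U = U * C * T := by
  rw [Units.eq_mul_inv_iff_mul_eq, mul_assoc, mul_assoc, Units.inv_mul_eq_iff_eq_mul,
    eq_comm, mul_assoc, mul_assoc]

/-- Criterion for `S U T⁻¹` to be of quaternion type `k` when `U` is. -/
theorem mul_mul_inv_mem_qtype_iff {k : Fin 4} {U : G 𝕜 p q r} (hU : U ∈ qtype 𝕜 p q r k)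
    (S T : (G 𝕜 p q r)ˣ) :
    ((S : G 𝕜 p q r) * U * ((T⁻¹ : (G 𝕜 p q r)ˣ) : G 𝕜 p q r)) ∈ qtype 𝕜 p q r k ↔
      rev (T : G 𝕜 p q r) * S * U = U * rev (S : G 𝕜 p q r) * T ∧
        inv (rev (T : G 𝕜 p q r)) * S * U = U * inv (rev (S : G 𝕜 p q r)) * T := by
  obtain ⟨h1, h2⟩ := hU
  rw [neg_one_pow_mul_eq_smul] at h1 h2
  have hs : ∀ (m : ℕ) (X Y : G 𝕜 p q r), (-1 : 𝕜) ^ m • X = (-1 : 𝕜) ^ m • Y ↔ X = Y :=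
    fun m X Y => (smul_right_injective _ (pow_ne_zero m (neg_ne_zero.2 one_ne_zero))).eq_iff
  have e1 : inv ((S : G 𝕜 p q r) * U * ((T⁻¹ : (G 𝕜 p q r)ˣ) : G 𝕜 p q r)) = (-1 : 𝕜) ^ (k : ℕ) •
      (inv (S : G 𝕜 p q r) * U * inv ((T⁻¹ : (G 𝕜 p q r)ˣ) : G 𝕜 p q r)) := by
    rw [inv_mul, inv_mul, h1, mul_smul_comm, smul_mul_assoc]
  have e2 : rev ((S : G 𝕜 p q r) * U * ((T⁻¹ : (G 𝕜 p q r)ˣ) : G 𝕜 p q r)) =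
      (-1 : 𝕜) ^ ((k : ℕ) * ((k : ℕ) - 1) / 2) •
      (rev ((T⁻¹ : (G 𝕜 p q r)ˣ) : G 𝕜 p q r) * U * rev (S : G 𝕜 p q r)) := by
    rw [rev_mul, rev_mul, h2, smul_mul_assoc, mul_smul_comm, mul_assoc]
  have c1 := units_conj_eq_iff (revUnit T) S (revUnit S) T U
  have c2 := units_conj_eq_iff (invUnit (revUnit T)) S (invUnit (revUnit S)) T U
  have c3 := units_conj_eq_iff (invUnit (revUnit T)) (invUnit S) (invUnit (revUnit S))
    (invUnit T) U
  simp only [coe_invUnit, coe_inv_invUnit, coe_revUnit, coe_inv_revUnit] at c1 c2 c3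
  rw [qtype, Set.mem_ofPred_eq, neg_one_pow_mul_eq_smul, neg_one_pow_mul_eq_smul, e1, e2, hs, hs,
    and_comm, c1]
  refine and_congr_right fun h => ?_
  -- Given the reversion condition, its image under the grade involution lets the remaining
  -- involution condition be replaced by one for the composite of both involutions, which is the
  -- second relation.
  have h' := congrArg inv h
  rw [inv_mul, inv_mul, inv_mul, inv_mul, h1, mul_smul_comm, smul_mul_assoc, smul_mul_assoc,
    hs, ← c3] at h'
  rw [← h', c2]

theorem Gam_eq (k : Fin 4) : Gam 𝕜 p q r k = normSet (typeCentralizer 𝕜 p q r 0 k) := by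
  ext T
  rw [mem_normSet_iff, Gam, Set.mem_ofPred_eq, Set.image_subset_iff]
  simp only [typeCentralizer, twist_zero, psi, chi]
  constructor
  · intro h
    exact ⟨fun V hV => by rw [← mul_assoc]; exact ((mul_mul_inv_mem_qtype_iff hV T T).1 (h hV)).1,
      fun V hV => by rw [← mul_assoc]; exact ((mul_mul_inv_mem_qtype_iff hV T T).1 (h hV)).2⟩
  · rintro ⟨h1, h2⟩ V hV
    refine (mul_mul_inv_mem_qtype_iff hV T T).2 ⟨?_, ?_⟩
    · rw [h1 V hV, mul_assoc]
    · rw [h2 V hV, mul_assoc]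

theorem GamCheck_eq (k : Fin 4) :
    GamCheck 𝕜 p q r k = normSet (typeCentralizer 𝕜 p q r 1 k) := by
  ext T
  -- With `S` the grade involution of `T`, the two norms trade places: the reversion relation yields
  -- `chi`, the composite one `psi`.
  have key : ∀ V ∈ qtype 𝕜 p q r k, adCheck T V ∈ qtype 𝕜 p q r k ↔
      inv (chi (T : G 𝕜 p q r)) * V = V * chi (T : G 𝕜 p q r) ∧
        inv (psi (T : G 𝕜 p q r)) * V = V * psi (T : G 𝕜 p q r) := by
    intro V hV
    rw [adCheck, ← coe_invUnit, mul_mul_inv_mem_qtype_iff hV, coe_invUnit, chi, psi, inv_mul,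
      inv_mul, inv_inv_apply, inv_rev, inv_rev, inv_inv_apply, mul_assoc V, mul_assoc V]
  rw [mem_normSet_iff, GamCheck, Set.mem_ofPred_eq, Set.image_subset_iff]
  simp only [typeCentralizer, twist_one]
  constructor
  · intro h
    exact ⟨fun V hV => ((key V hV).1 (h hV)).2, fun V hV => ((key V hV).1 (h hV)).1⟩
  · rintro ⟨h1, h2⟩ V hV
    exact (key V hV).2 ⟨h2 V hV, h1 V hV⟩

/-! ### The second twisted action on elements of definite parity, and assembly -/

theorem adTilde_of_even {U : G 𝕜 p q r} (hU : inv U = U) (T : (G 𝕜 p q r)ˣ) :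
    adTilde T U = ad T U := by
  have h0 : proj0 U = U := by
    rw [proj0, hU, ← two_smul 𝕜 U, smul_smul, inv_mul_cancel₀ two_ne_zero, one_smul]
  have h1 : proj1 U = 0 := by
    rw [proj1, hU, sub_self, smul_zero]
  rw [adTilde, h0, h1, mul_zero, zero_mul, add_zero, ad]

theorem adTilde_of_odd {U : G 𝕜 p q r} (hU : inv U = -U) (T : (G 𝕜 p q r)ˣ) :
    adTilde T U = adCheck T U := by
  have h0 : proj0 U = 0 := by
    rw [proj0, hU, add_neg_cancel, smul_zero]
  have h1 : proj1 U = U := by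
    rw [proj1, hU, sub_neg_eq_add, ← two_smul 𝕜 U, smul_smul, inv_mul_cancel₀ two_ne_zero,
      one_smul]
  rw [adTilde, h0, h1, mul_zero, zero_mul, zero_add, adCheck]

theorem GamTilde_of_even {k : Fin 4} (hk : Even (k : ℕ)) :
    GamTilde 𝕜 p q r k = Gam 𝕜 p q r k := by
  ext T
  have h : adTilde T '' qtype 𝕜 p q r k = ad T '' qtype 𝕜 p q r k :=
    Set.image_congr fun U hU => adTilde_of_even (by rw [hU.1, hk.neg_one_pow, one_mul]) T
  rw [GamTilde, Gam, Set.mem_ofPred_eq, Set.mem_ofPred_eq, h]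

theorem GamTilde_of_odd {k : Fin 4} (hk : Odd (k : ℕ)) :
    GamTilde 𝕜 p q r k = GamCheck 𝕜 p q r k := by
  ext T
  have h : adTilde T '' qtype 𝕜 p q r k = adCheck T '' qtype 𝕜 p q r k :=
    Set.image_congr fun U hU => adTilde_of_odd (by rw [hU.1, hk.neg_one_pow, neg_one_mul]) T
  rw [GamTilde, GamCheck, Set.mem_ofPred_eq, Set.mem_ofPred_eq, h]

theorem QCheck_zero_eq : QCheck 𝕜 p q r 0 = GamCheck 𝕜 p q r 0 := by
  rw [GamCheck_eq, ← Z_four_inter_parity_eq]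
  rfl

theorem QCheck_one_eq : QCheck 𝕜 p q r 1 = GamCheck 𝕜 p q r 1 := by
  rw [GamCheck_eq, ← ZCheck_one_eq]
  rfl

theorem QCheck_two_eq : QCheck 𝕜 p q r 2 = GamCheck 𝕜 p q r 2 := by
  rw [GamCheck_eq, ← ZCheck_two_eq]
  rfl

theorem QCheck_three_eq : QCheck 𝕜 p q r 3 = GamCheck 𝕜 p q r 3 := by
  rw [GamCheck_eq, ← ZCheck_three_eq]
  rfl

theorem Q_zero_eq : Q 𝕜 p q r 0 = Gam 𝕜 p q r 0 := by
  rw [Gam_eq, ← Z_four_eq]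
  rfl

theorem Q_two_eq : Q 𝕜 p q r 2 = Gam 𝕜 p q r 2 := by
  rw [Gam_eq, ← Z_two_eq]
  rfl

end GeomAlg

end

theorem mainTheorem2 {𝕜 : Type*} [RCLike 𝕜] (p q r : ℕ) (hn : 1 ≤ p + q + r) :
    (GeomAlg.QCheck 𝕜 p q r 1 = GeomAlg.GamCheck 𝕜 p q r 1 ∧
      GeomAlg.QCheck 𝕜 p q r 1 ⊆ GeomAlg.QCheck 𝕜 p q r 3 ∧
      GeomAlg.QCheck 𝕜 p q r 3 = GeomAlg.GamCheck 𝕜 p q r 3 ∧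
      GeomAlg.QCheck 𝕜 p q r 2 = GeomAlg.GamCheck 𝕜 p q r 2 ∧
      GeomAlg.QCheck 𝕜 p q r 0 = GeomAlg.GamCheck 𝕜 p q r 0) ∧
    (GeomAlg.GamTilde 𝕜 p q r 1 = GeomAlg.GamCheck 𝕜 p q r 1 ∧
      GeomAlg.GamTilde 𝕜 p q r 3 = GeomAlg.GamCheck 𝕜 p q r 3 ∧
      GeomAlg.GamTilde 𝕜 p q r 1 = GeomAlg.QCheck 𝕜 p q r 1 ∧
      GeomAlg.GamTilde 𝕜 p q r 3 = GeomAlg.QCheck 𝕜 p q r 3) ∧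
    (GeomAlg.GamTilde 𝕜 p q r 0 = GeomAlg.Gam 𝕜 p q r 0 ∧
      GeomAlg.GamTilde 𝕜 p q r 2 = GeomAlg.Gam 𝕜 p q r 2 ∧
      GeomAlg.GamTilde 𝕜 p q r 0 = GeomAlg.Q 𝕜 p q r 0 ∧
      GeomAlg.GamTilde 𝕜 p q r 2 = GeomAlg.Q 𝕜 p q r 2) := by
  have t0 : GeomAlg.GamTilde 𝕜 p q r 0 = GeomAlg.Gam 𝕜 p q r 0 :=
    GeomAlg.GamTilde_of_even (by decide)
  have t1 : GeomAlg.GamTilde 𝕜 p q r 1 = GeomAlg.GamCheck 𝕜 p q r 1 :=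
    GeomAlg.GamTilde_of_odd (by decide)
  have t2 : GeomAlg.GamTilde 𝕜 p q r 2 = GeomAlg.Gam 𝕜 p q r 2 :=
    GeomAlg.GamTilde_of_even (by decide)
  have t3 : GeomAlg.GamTilde 𝕜 p q r 3 = GeomAlg.GamCheck 𝕜 p q r 3 :=
    GeomAlg.GamTilde_of_odd (by decide)
  exact ⟨⟨GeomAlg.QCheck_one_eq, GeomAlg.normSet_mono GeomAlg.ZCheck_one_subset_three,
      GeomAlg.QCheck_three_eq, GeomAlg.QCheck_two_eq, GeomAlg.QCheck_zero_eq⟩,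
    ⟨t1, t3, t1.trans GeomAlg.QCheck_one_eq.symm, t3.trans GeomAlg.QCheck_three_eq.symm⟩,
    ⟨t0, t2, t0.trans GeomAlg.Q_zero_eq.symm, t2.trans GeomAlg.Q_two_eq.symm⟩⟩
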